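/- **Setting.** Fix constants $\beta>1$, $\varepsilon\in(0,1)$, $\omega>1$, $\omega'>1$ and an integer $K^*$. For label vectors $z\in[K]^n$ and a symmetric matrix $P\in[0,1]^{K\times K}$, the stochastic block model $\mathrm{SBM}(z,P)$ is the law of the random symmetric matrix $A\in\{0,1\}^{n\times n}$ with $A_{ii}=0$ and with independent entries $A_{ij}=A_{ji}\sim\mathrm{Bern}(P_{z_iz_j})$, $i>j$. An estimator $\hat z$ is a (possibly randomized) function of $A$ with values in $[K]^n$, and its misclassification rate is $$\mathrm{mis}(\hat z,z)=\min_{\pi\in S_K}\frac1n\sum_{i=1}^n \mathbf 1\{\pi(\hat z_i)\neq z_i\}.$$ For two probability laws on a countable set with mass functions $\varphi_0,\varphi_1$, the Chernoff information is $$D(\varphi_0\|\varphi_1)=\sup_{0<\alpha<1}\Big(-\log\sum_x\varphi_0(x)^{1-\alpha}\varphi_1(x)^{\alpha}\Big).$$ For $p^*\in(0,1)$ and $D^*\in\mathbb R$ let $\mathcal S(n,p^*,K,D^*)$ be the set of all $(z,P)$ with $z\in[K]^n$, $P\in(0,1)^{K\times K}$, $P=P^\top$, such that * $\frac{n}{\beta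 K}\le|\{i:z_i=k\}|\le\frac{\beta n}{K}$ for all $k\in[K]$; * $\max_{k,\ell}P_{k\ell}=p^*\le1-\varepsilon$ and $\max_{k,\ell}P_{k\ell}\big/\min_{k,\ell}P_{k\ell}\le\omega$; * $\min_{k\neq\ell}\max_{r\in[K]}\max\Big(\frac{P_{kr}}{P_{\ell r}},\frac{P_{\ell r}}{P_{kr}}\Big)\ge\omega'$; * $D\Big(\bigotimes_{j=1}^n\mathrm{Bern}(P_{kz_j})\,\Big\|\,\bigotimes_{j=1}^n\mathrm{Bern}(P_{\ell z_j})\Big)\ge D^*$ for all $k\neq\ell$. **Theorem (minimax lower bound).** There are constants $C,c>0$ depending only on $\beta,\varepsilon,K^*,\omega,\omega'$ such that the following holds for all integers $n$ and $K$ with $3\le K\le K^*$, all $p^*\in(0,1)$ and all $D^*\in\mathbb R$. If $np^*\ge C$, and if there is $q$ with $0<q<p^*\le1-\varepsilon$, $\omega'\le p^*/q\le\omega$ and $$D^*=D\big(\mathrm{Bin}(\lfloor n/K\rfloor,p^*)\,\big\|\,\mathrm{Bin}(\lfloor n/K\rfloor,q)\big),$$ then $$\inf_{\hat z}\ \sup_{(z,P)\in\mathcal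 S(n,p^*,K,D^*)}\mathbb E_{A\sim\mathrm{SBM}(z,P)}\big[\mathrm{mis}(\hat z,z)\big]\ \ge\ \frac{c}{\sqrt{np^*}}\,e^{-D^*},$$ where the infimum is over all estimators $\hat z$. -/

import Mathlib

open MeasureTheory ProbabilityTheory

/-! Vectors of labels are functions `Fin n → Fin K`; adjacency matrices with entries in `{0, 1}` are
functions `Fin n → Fin n → Bool` (with `true` for `1`). -/

section Chernoff

/-- Chernoff `α`-divergence `-log ∑ₓ φ₀(x)^(1-α) φ₁(x)^α` of two laws on a countable space, where
`φ₀`, `φ₁` are their probability mass functions. -/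
noncomputable def chernoffDiv {X : Type*} [MeasurableSpace X] (α : ℝ) (μ ν : Measure X) : ℝ :=
  -Real.log (∑' x, (μ.real {x}) ^ (1 - α) * (ν.real {x}) ^ α)

/-- Chernoff information: the largest Chernoff `α`-divergence over `α ∈ (0, 1)`. -/
noncomputable def chernoffInfo {X : Type*} [MeasurableSpace X] (μ ν : Measure X) : ℝ :=
  ⨆ α : Set.Ioo (0 : ℝ) 1, chernoffDiv (α : ℝ) μ ν

end Chernoff

namespace SBM

/-- The product law `⨂ⱼ Bern(p j)` on `{0, 1}ⁿ`. -/
noncomputable def bernoulliVector {n : ℕ} (p : Fin n → unitInterval) : Measure (Fin n → Bool) :=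
  Measure.pi fun j => bernoulliMeasure true false (p j)

/-- The pairs `(i, j)` with `i > j`. -/
abbrev LowerPairs (n : ℕ) : Type := {e : Fin n × Fin n // e.2 < e.1}

/-- The symmetric matrix with zero diagonal that has the given entries below the diagonal. -/
def symmMatrix {n : ℕ} (x : LowerPairs n → Bool) : Fin n → Fin n → Bool := fun i j =>
  if h : j < i then x ⟨(i, j), h⟩ else if h : i < j then x ⟨(j, i), h⟩ else false

/-- The law of the adjacency matrix of the stochastic block model with labels `z` and connectivity
matrix `P`: the entries `A i j = A j i ∼ Bern(P (z i) (z j))`, `i > j`, are independent, and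
`A i i = 0`. -/
noncomputable def law {n K : ℕ} (z : Fin n → Fin K) (P : Matrix (Fin K) (Fin K) unitInterval) :
    Measure (Fin n → Fin n → Bool) :=
  (Measure.pi fun e : LowerPairs n =>
    bernoulliMeasure true false (P (z e.1.1) (z e.1.2))).map symmMatrix

/-- The misclassification rate of the estimate `y` of `z`: the proportion of wrong labels,
minimized over all relabellings of the communities. -/
noncomputable def mis {n K : ℕ} (y z : Fin n → Fin K) : ℝ :=
  ⨅ π : Equiv.Perm (Fin K), (1 / (n : ℝ)) * ∑ i, if π (y i) ≠ z i then (1 : ℝ) else 0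

/-- A (possibly randomized) estimator of the labels: given the adjacency matrix it returns a
random label vector. The non-randomized estimators are those of the form
`fun A => PMF.pure (f A)`. -/
abbrev Estimator (n K : ℕ) : Type := (Fin n → Fin n → Bool) → PMF (Fin n → Fin K)

/-- The expected misclassification rate of the estimator `zhat` in the model `θ = (z, P)`. -/
noncomputable def risk {n K : ℕ} (zhat : Estimator n K)
    (θ : (Fin n → Fin K) × Matrix (Fin K) (Fin K) unitInterval) : ℝ :=
  ∫ A, ∑ y, (zhat A y).toReal * mis y θ.1 ∂(law θ.1 θ.2)

/-- The minimax risk over a class `S` of models. All risks lie in `[0, 1]`, so that the suprema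
and the infimum of real numbers are genuine ones. -/
noncomputable def minimaxRisk {n K : ℕ}
    (S : Set ((Fin n → Fin K) × Matrix (Fin K) (Fin K) unitInterval)) : ℝ :=
  ⨅ zhat : Estimator n K, ⨆ θ : S, risk zhat θ

/-- The size of community `k`. -/
def communitySize {n K : ℕ} (z : Fin n → Fin K) (k : Fin K) : ℕ :=
  (Finset.univ.filter fun i => z i = k).card

/-- The parameter space `𝒮(n, p*, K, D*)` (with the constants `β, ε, ω, ω'`), as a predicate on
`(z, P)`. -/
structure Admissible (β ε ω ω' : ℝ) {n K : ℕ} (pstar : unitInterval) (Dstar : ℝ)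
    (z : Fin n → Fin K) (P : Matrix (Fin K) (Fin K) unitInterval) : Prop where
  pos : ∀ k l, 0 < (P k l : ℝ)
  lt_one : ∀ k l, (P k l : ℝ) < 1
  symm : P.IsSymm
  balanced : ∀ k, (n : ℝ) / (β * K) ≤ communitySize z k ∧ (communitySize z k : ℝ) ≤ β * n / K
  max_eq : (∀ k l, P k l ≤ pstar) ∧ ∃ k l, P k l = pstar
  max_le : (pstar : ℝ) ≤ 1 - ε
  ratio_le : ∀ k l k' l', (P k l : ℝ) / P k' l' ≤ ω
  separated : ∀ k l, k ≠ l →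
    ∃ r, ω' ≤ max ((P k r : ℝ) / P l r) ((P l r : ℝ) / P k r)
  chernoff : ∀ k l, k ≠ l →
    Dstar ≤ chernoffInfo (bernoulliVector fun j => P k (z j)) (bernoulliVector fun j => P l (z j))

/-- The parameter space `𝒮(n, p*, K, D*)`. -/
def paramSpace (β ε ω ω' : ℝ) (n : ℕ) (pstar : unitInterval) (K : ℕ) (Dstar : ℝ) :
    Set ((Fin n → Fin K) × Matrix (Fin K) (Fin K) unitInterval) :=
  {θ | Admissible β ε ω ω' pstar Dstar θ.1 θ.2}

end SBM

/-! The bound comes from a family of models in which a constant fraction of the vertices have a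
label that is either 0 or 1, each independently of the others. Labels follow consecutive blocks of
length m = ⌊n/K⌋, the first s ≈ γn/K vertices are uncertain, and P is the half-graph matrix. Its
rows 0 and 1 differ only in column K - 1, so flipping one uncertain label changes exactly the m
edges to the last block, from Bern(q) to Bern(p). Any two rows differ in a column r ≥ 1, whose
community keeps at least m vertices whatever the flips; hence all these models meet the Chernoff
constraint (`SBM.admissible_blockLabel`).

Communities have at least 4s vertices, so one relabelling of an estimate serves the whole family
(`SBM.exists_perm_sum_le_mis`), and averaging over flips bounds the risk below by (s/n)·V/2, where V
bounds the overlap ∑ min of two neighbouring models (`SBM.exists_risk_ge`).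

The overlap is at least the smaller of the Bin(m, p) and Bin(m, q) masses at a single point k
(`overlap_prod_bernoulliMass`). With k = ⌊mr⌋, where Bern(r) is the tilt whose two likelihoods
agree, Stirling gives both masses order (mp)^(-1/2) times the m-th power of the affinity
(`exists_common_binomial_point`), and that power is at least e^(-D*). -/

/-! ### Stirling estimates and the binomial mass near its mean -/

theorem factorial_le_stirling {n : ℕ} (hn : 1 ≤ n) :
    (n.factorial : ℝ) ≤ Real.exp 1 * √n * (n / Real.exp 1) ^ n := by
  obtain ⟨k, rfl⟩ : ∃ k, n = k + 1 := ⟨n - 1, by omega⟩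
  have h := Stirling.stirlingSeq'_antitone (Nat.zero_le k)
  simp only [Function.comp, Nat.succ_eq_add_one, zero_add, Stirling.stirlingSeq_one] at h
  rw [Stirling.stirlingSeq, div_le_iff₀ (by positivity)] at h
  refine h.trans (le_of_eq ?_)
  rw [Real.sqrt_mul (by norm_num)]
  field_simp

/-- Stirling for all three factorials. The upper bounds on k! and (m - k)! cost a factor e each, and
√(2πm) from m! absorbs √(m - k). -/
theorem choose_lower_bound {m k : ℕ} (hk : 1 ≤ k) (hkm : k + 1 ≤ m) :
    Real.exp (-2) / √k * (m : ℝ) ^ m ≤ (m.choose k : ℝ) * ((k : ℝ) ^ k * ((m : ℝ) - k) ^ (m - k)) := by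
  obtain ⟨l, rfl⟩ : ∃ l, m = k + l := ⟨m - k, by omega⟩
  have hl : 1 ≤ l := by omega
  have e1 := factorial_le_stirling hk
  have e2 := factorial_le_stirling hl
  have e3 := Stirling.le_factorial_stirling (k + l)
  have e4 : ((k + l).choose k : ℝ) * k.factorial * l.factorial = (k + l).factorial := by
    rw [Nat.choose_symm_add]
    exact_mod_cast Nat.add_choose_mul_factorial_mul_factorial k l
  have hk0 : (0 : ℝ) < k := by exact_mod_cast hk
  have hl0 : (0 : ℝ) < l := by exact_mod_cast hl
  have e5 : √(l : ℝ) ≤ √(2 * Real.pi * ((k + l : ℕ) : ℝ)) := by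
    apply Real.sqrt_le_sqrt
    push_cast
    nlinarith [Real.pi_gt_three]
  have key : √(l : ℝ) * (((k + l : ℕ) : ℝ) / Real.exp 1) ^ (k + l) ≤
      ((k + l).choose k : ℝ) * (Real.exp 1 * √k * (k / Real.exp 1) ^ k) *
        (Real.exp 1 * √l * (l / Real.exp 1) ^ l) := by
    refine le_trans (mul_le_mul_of_nonneg_right e5 (by positivity)) (e3.trans ?_)
    rw [← e4]
    gcongr
  have hE : Real.exp (-2) = 1 / (Real.exp 1 * Real.exp 1) := by
    rw [← Real.exp_add, one_div, ← Real.exp_neg]; norm_num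
  rw [hE]
  simp only [Nat.add_sub_cancel_left]
  have : (((k + l : ℕ) : ℝ) - k) = l := by push_cast; ring
  rw [this]
  have hsk : 0 < √(k : ℝ) := Real.sqrt_pos.2 hk0
  have hsl : 0 < √(l : ℝ) := Real.sqrt_pos.2 hl0
  simp only [div_pow, pow_add] at key ⊢
  have hexp := Real.exp_pos 1
  rw [div_div, div_mul_eq_mul_div, div_le_iff₀ (by positivity)]
  set E := Real.exp 1
  have := mul_le_mul_of_nonneg_right key (show 0 ≤ E ^ k * E ^ l / √(l : ℝ) by positivity)
  field_simp at this
  nlinarith [this]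

theorem binomial_mode_lower_bound {m k : ℕ} {r : ℝ} (hr0 : 0 < r) (hr1 : r < 1) (hk : 1 ≤ k)
    (hkm : k + 2 ≤ m) (hk1 : (k : ℝ) ≤ m * r) (hk2 : (m : ℝ) * r ≤ k + 1) :
    Real.exp (-4) / √(m * r) ≤ (m.choose k : ℝ) * (r ^ k * (1 - r) ^ (m - k)) := by
  have h1 := choose_lower_bound hk (by omega : k + 1 ≤ m)
  have hk0 : (0 : ℝ) < k := by exact_mod_cast hk
  have hm0 : (0 : ℝ) < m := by exact_mod_cast (by omega : 0 < m)
  have hN : (2 : ℝ) ≤ (m : ℝ) - k := by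
    have : ((k + 2 : ℕ) : ℝ) ≤ m := by exact_mod_cast hkm
    push_cast at this; linarith
  have hcast : ((m - k : ℕ) : ℝ) = (m : ℝ) - k := by rw [Nat.cast_sub (by omega)]
  -- Rounding mr down to k costs at most 1 here: m(1 - r) ≥ N - 1 ≥ N e^(-2/N) with N = m - k ≥ 2.
  -- The N-th power loses only e^(-2).
  have hbase : ((m : ℝ) - k) * Real.exp (-(2 / ((m : ℝ) - k))) ≤ m * (1 - r) := by
    set N := (m : ℝ) - k
    have : N * Real.exp (-(2 / N)) ≤ N - 1 := by
      rw [Real.exp_neg, ← div_eq_mul_inv, div_le_iff₀ (Real.exp_pos _)]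
      have h3 := Real.add_one_le_exp (2 / N)
      have h4 : N ≤ (N - 1) * (2 / N + 1) := by
        have : (N - 1) * (2 / N + 1) = N + 1 - 2 / N := by field_simp; ring
        rw [this]
        have : 2 / N ≤ 1 := by rw [div_le_one (by linarith)]; exact hN
        linarith
      nlinarith
    have : N = (m : ℝ) - k := rfl
    nlinarith
  have hpow : ((m : ℝ) - k) ^ (m - k) * Real.exp (-2) ≤ (m * (1 - r)) ^ (m - k) := by
    have := pow_le_pow_left₀ (by positivity) hbase (m - k)
    have hN0 : (m : ℝ) - k ≠ 0 := by linarith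
    rwa [mul_pow, ← Real.exp_nat_mul, hcast, mul_neg, mul_div_cancel₀ _ hN0] at this
  have hpow2 : (k : ℝ) ^ k ≤ (m * r) ^ k := pow_le_pow_left₀ hk0.le hk1 k
  have hsq : √(k : ℝ) ≤ √(m * r) := Real.sqrt_le_sqrt hk1
  have hsk : 0 < √(k : ℝ) := Real.sqrt_pos.2 hk0
  have hE : Real.exp (-4) = Real.exp (-2) * Real.exp (-2) := by rw [← Real.exp_add]; norm_num
  have hmm : (m : ℝ) ^ m = m ^ k * m ^ (m - k) := by rw [← pow_add]; congr 1; omega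
  have step : Real.exp (-2) / √k * (m : ℝ) ^ m * Real.exp (-2) ≤
      (m.choose k : ℝ) * ((r ^ k * (1 - r) ^ (m - k))) * (m : ℝ) ^ m := by
    refine (mul_le_mul_of_nonneg_right h1 (Real.exp_pos _).le).trans ?_
    have : (k : ℝ) ^ k * (((m : ℝ) - k) ^ (m - k) * Real.exp (-2)) ≤
        (m * r) ^ k * (m * (1 - r)) ^ (m - k) :=
      mul_le_mul hpow2 hpow (mul_nonneg (pow_nonneg (by linarith) _) (Real.exp_pos _).le)
        (by positivity)
    rw [mul_pow, mul_pow] at this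
    rw [hmm]
    calc _ = (m.choose k : ℝ) *
          ((k : ℝ) ^ k * (((m : ℝ) - k) ^ (m - k) * Real.exp (-2))) := by ring
      _ ≤ _ := mul_le_mul_of_nonneg_left this (by positivity)
      _ = _ := by ring
  have step2 : Real.exp (-2) / √k * Real.exp (-2) ≤
      (m.choose k : ℝ) * ((r ^ k * (1 - r) ^ (m - k))) := by
    refine le_of_mul_le_mul_right ?_ (pow_pos hm0 m)
    linarith
  refine le_trans ?_ step2
  rw [hE, div_mul_eq_mul_div]
  exact div_le_div_of_nonneg_left (by positivity) hsk hsq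

/-! ### Bernoulli affinity, the equalizing tilt and the common binomial point -/

/-- The sum `∑ₓ φ₀(x)^(1-α) φ₁(x)^α` for two Bernoulli laws. -/
noncomputable def bernoulliAffinity (α p q : ℝ) : ℝ :=
  p ^ (1 - α) * q ^ α + (1 - p) ^ (1 - α) * (1 - q) ^ α

theorem bernoulliAffinity_pos {α p q : ℝ} (hp0 : 0 < p) (hp1 : p < 1) (hq0 : 0 < q)
    (hq1 : q < 1) : 0 < bernoulliAffinity α p q := by
  have : 0 < 1 - p := by linarith
  have : 0 < 1 - q := by linarith
  unfold bernoulliAffinity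
  positivity

theorem bernoulliAffinity_le_one {α p q : ℝ} (hα0 : 0 < α) (hα1 : α < 1) (hp0 : 0 < p)
    (hp1 : p < 1) (hq0 : 0 < q) (hq1 : q < 1) : bernoulliAffinity α p q ≤ 1 := by
  have h1 := Real.geom_mean_le_arith_mean2_weighted (by linarith : 0 ≤ 1 - α) hα0.le hp0.le hq0.le
    (by ring)
  have h2 := Real.geom_mean_le_arith_mean2_weighted (by linarith : 0 ≤ 1 - α) hα0.le
    (by linarith : 0 ≤ 1 - p) (by linarith : 0 ≤ 1 - q) (by ring)
  unfold bernoulliAffinity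
  linarith

/-- The point `r` between `q` and `p` at which the likelihoods of the two Bernoulli laws agree, and
the exponent `α` for which the normalized geometric mean of the two laws is `Bern(r)`. -/
theorem exists_equalizing_tilt {p q : ℝ} (hq0 : 0 < q) (hqp : q < p) (hp1 : p < 1) :
    ∃ r α : ℝ, q < r ∧ r < p ∧ 0 < α ∧ α < 1 ∧
      r * Real.log p + (1 - r) * Real.log (1 - p) = r * Real.log q + (1 - r) * Real.log (1 - q) ∧
      Real.log (bernoulliAffinity α p q) = r * (Real.log p - Real.log r) +
        (1 - r) * (Real.log (1 - p) - Real.log (1 - r)) := by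
  have hp0 : 0 < p := hq0.trans hqp
  have h1p : 0 < 1 - p := by linarith
  have h1q : 0 < 1 - q := by linarith
  have hl1 : Real.log q < Real.log p := Real.log_lt_log hq0 hqp
  have hl2 : Real.log (1 - p) < Real.log (1 - q) := Real.log_lt_log h1p (by linarith)
  have hdiv : ∀ x y : ℝ, 0 < x → 0 < y → x ≠ y → Real.log x - Real.log y < x / y - 1 := by
    intro x y hx hy hxy
    rw [← Real.log_div hx.ne' hy.ne']
    refine Real.log_lt_sub_one_of_pos (by positivity) ?_
    rwa [Ne, div_eq_one_iff_eq hy.ne']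
  -- Strict positivity of relative entropy. Used in both directions, it places the root r of the
  -- affine likelihood equation strictly between q and p.
  have kl : ∀ x y : ℝ, 0 < x → x < 1 → 0 < y → y < 1 → x ≠ y →
      x * (Real.log y - Real.log x) + (1 - x) * (Real.log (1 - y) - Real.log (1 - x)) < 0 := by
    intro x y hx hx1 hy hy1 hxy
    have a := mul_lt_mul_of_pos_left (hdiv y x hy hx hxy.symm) hx
    have b := mul_lt_mul_of_pos_left (hdiv (1 - y) (1 - x) (by linarith) (by linarith)
      (fun h => hxy (by linarith))) (by linarith : 0 < 1 - x)
    have a' : x * (y / x - 1) = y - x := by field_simp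
    have b' : (1 - x) * ((1 - y) / (1 - x) - 1) = x - y := by
      have : (1 - x) ≠ 0 := by linarith
      field_simp; ring
    linarith
  have k1 := kl q p hq0 (by linarith) hp0 hp1 hqp.ne
  have k2 := kl p q hp0 hp1 hq0 (by linarith) hqp.ne'
  set lp := Real.log p
  set lq := Real.log q
  set mp := Real.log (1 - p)
  set mq := Real.log (1 - q)
  set Lg := (lp - lq) + (mq - mp) with hLg
  have hL : 0 < Lg := by linarith
  set r := (mq - mp) / Lg with hr
  have hrL : r * Lg = mq - mp := by rw [hr]; field_simp
  have hqr : q < r := by rw [hr, lt_div_iff₀ hL]; nlinarith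
  have hrp : r < p := by rw [hr, div_lt_iff₀ hL]; nlinarith
  have hr0 : 0 < r := hq0.trans hqr
  have hr1 : 0 < 1 - r := by linarith
  have g1 : lq < Real.log r := Real.log_lt_log hq0 hqr
  have g2 : Real.log r < lp := Real.log_lt_log hr0 hrp
  have g3 : Real.log (1 - r) < mq := Real.log_lt_log hr1 (by linarith)
  have g4 : mp < Real.log (1 - r) := Real.log_lt_log h1p (by linarith)
  set lr := Real.log r
  set mr := Real.log (1 - r)
  set α := ((lp - mp) - (lr - mr)) / Lg with hα
  have hαL : α * Lg = (lp - mp) - (lr - mr) := by rw [hα]; field_simp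
  refine ⟨r, α, hqr, hrp, div_pos (by linarith) hL, ?_, ?_, ?_⟩
  · rw [hα, div_lt_one hL]; linarith
  · linear_combination hrL
  -- By the choice of α, the two terms of the affinity are r e^t and (1 - r) e^t with the same t, so
  -- the affinity is e^t.
  · have ht : ∃ t, lp * (1 - α) + lq * α = t + lr ∧ mp * (1 - α) + mq * α = t + mr := by
      refine ⟨lp * (1 - α) + lq * α - lr, by ring, ?_⟩
      linear_combination hαL
    obtain ⟨t, t1, t2⟩ := ht
    have haff : bernoulliAffinity α p q = Real.exp t := by
      rw [bernoulliAffinity, Real.rpow_def_of_pos hp0, Real.rpow_def_of_pos hq0,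
        Real.rpow_def_of_pos h1p, Real.rpow_def_of_pos h1q, ← Real.exp_add, ← Real.exp_add]
      change Real.exp (lp * (1 - α) + lq * α) + Real.exp (mp * (1 - α) + mq * α) = _
      rw [t1, t2, Real.exp_add, Real.exp_add, Real.exp_log hr0, Real.exp_log hr1]
      ring
    rw [haff, Real.log_exp]
    linear_combination (-r) * t1 - (1 - r) * t2 - α * hrL

/-- Some point `k` carries, under both `Bin(m, p)` and `Bin(m, q)`, mass of order
`(m p)^(-1/2) (∑ₓ φ₀(x)^(1-α) φ₁(x)^α)^m`. -/
theorem exists_common_binomial_point {p q ε ω : ℝ} {m : ℕ} (hε : 0 < ε) (hω : 0 < ω)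
    (hq0 : 0 < q) (hqp : q < p) (hpε : p ≤ 1 - ε) (hpω : p / q ≤ ω) (hmq : 1 ≤ m * q)
    (hmε : 2 ≤ m * ε) :
    ∃ k ≤ m, ∃ α, 0 < α ∧ α < 1 ∧
      Real.exp (-4) * (ε / ω) / √(m * p) * bernoulliAffinity α p q ^ m ≤
        (m.choose k : ℝ) * min (p ^ k * (1 - p) ^ (m - k)) (q ^ k * (1 - q) ^ (m - k)) := by
  have hp1 : p < 1 := by linarith
  obtain ⟨r, α, hqr, hrp, hα0, hα1, heq, haff⟩ := exists_equalizing_tilt hq0 hqp hp1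
  have hm0 : (0 : ℝ) < m := by
    rcases Nat.eq_zero_or_pos m with h | h
    · subst h; norm_num at hmq
    · exact_mod_cast h
  have hr0 : 0 < r := hq0.trans hqr
  have hp0 : 0 < p := hr0.trans hrp
  have hr1 : 0 < 1 - r := by linarith
  have h1p : 0 < 1 - p := by linarith
  have h1q : 0 < 1 - q := by linarith
  set k := ⌊(m : ℝ) * r⌋₊ with hk
  have hk1 : (k : ℝ) ≤ m * r := Nat.floor_le (by positivity)
  have hk2 : (m : ℝ) * r < k + 1 := Nat.lt_floor_add_one _
  have hk3 : 1 ≤ k := Nat.le_floor (by push_cast; nlinarith)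
  -- Here k ≤ mr ≤ m(1 - ε) ≤ m - 2.
  have hkm : k + 2 ≤ m := by
    have : ((k + 2 : ℕ) : ℝ) ≤ m := by push_cast; nlinarith
    exact_mod_cast this
  have hmode := binomial_mode_lower_bound hr0 (by linarith) hk3 hkm hk1 hk2.le
  have hcast : ((m - k : ℕ) : ℝ) = (m : ℝ) - k := by rw [Nat.cast_sub (by omega)]
  have hprod : ∀ x : ℝ, 0 < x → 0 < 1 - x → x ^ k * (1 - x) ^ (m - k) =
      Real.exp (k * Real.log x + ((m : ℝ) - k) * Real.log (1 - x)) := by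
    intro x hx hx1
    rw [Real.exp_add, ← hcast, Real.exp_nat_mul, Real.exp_nat_mul, Real.exp_log hx,
      Real.exp_log hx1]
  have hA : bernoulliAffinity α p q ^ m = Real.exp (m * Real.log (bernoulliAffinity α p q)) := by
    rw [Real.exp_nat_mul, Real.exp_log (bernoulliAffinity_pos hp0 hp1 hq0 (by linarith))]
  have hεω : ε / ω ≤ Real.exp (-((Real.log p - Real.log (1 - p)) -
      (Real.log q - Real.log (1 - q)))) := by
    have : Real.exp (-((Real.log p - Real.log (1 - p)) - (Real.log q - Real.log (1 - q)))) =
        q * (1 - p) / (p * (1 - q)) := by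
      rw [show -((Real.log p - Real.log (1 - p)) - (Real.log q - Real.log (1 - q))) =
        (Real.log q + Real.log (1 - p)) - (Real.log p + Real.log (1 - q)) by ring,
        Real.exp_sub, Real.exp_add, Real.exp_add, Real.exp_log hq0, Real.exp_log hp0,
        Real.exp_log h1p, Real.exp_log h1q]
    rw [this, div_le_div_iff₀ hω (by positivity)]
    rw [div_le_iff₀ hq0] at hpω
    have i1 : ε * (p * (1 - q)) ≤ ε * p := by nlinarith [mul_pos hε (mul_pos hp0 hq0)]
    have i2 : ε * p ≤ (1 - p) * (ω * q) := mul_le_mul (by linarith) hpω hp0.le h1p.le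
    linarith
  have g1 : Real.log q < Real.log r := Real.log_lt_log hq0 hqr
  have g2 : Real.log r < Real.log p := Real.log_lt_log hr0 hrp
  have g3 : Real.log (1 - r) < Real.log (1 - q) := Real.log_lt_log hr1 (by linarith)
  have g4 : Real.log (1 - p) < Real.log (1 - r) := Real.log_lt_log h1p (by linarith)
  -- At the real point mr the likelihood ratio of Bern(x) to Bern(r) is exactly the affinity to the
  -- power m. Rounding to k multiplies it by exp(-(mr - k)(logit x - logit r)): a loss of at most
  -- ε/ω for x = p, a gain for x = q.
  have hmain : ∀ x : ℝ, 0 < x → 0 < 1 - x →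
      r * Real.log x + (1 - r) * Real.log (1 - x) = r * Real.log p + (1 - r) * Real.log (1 - p) →
      (m * r - k) * ((Real.log x - Real.log (1 - x)) - (Real.log r - Real.log (1 - r))) ≤
        (Real.log p - Real.log (1 - p)) - (Real.log q - Real.log (1 - q)) →
      (ε / ω) * bernoulliAffinity α p q ^ m * (r ^ k * (1 - r) ^ (m - k)) ≤
        x ^ k * (1 - x) ^ (m - k) := by
    intro x hx hx1 hxe hxl
    rw [hprod x hx hx1, hprod r hr0 hr1, hA, haff]
    refine (mul_le_mul_of_nonneg_right (mul_le_mul_of_nonneg_right hεω (Real.exp_pos _).le)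
      (Real.exp_pos _).le).trans ?_
    rw [← Real.exp_add, ← Real.exp_add, Real.exp_le_exp]
    have := congrArg (fun t => (m : ℝ) * t) hxe
    nlinarith
  have hp' := hmain p hp0 h1p rfl (by
    have : (m * r - k) * ((Real.log p - Real.log (1 - p)) - (Real.log r - Real.log (1 - r))) ≤
      1 * ((Real.log p - Real.log (1 - p)) - (Real.log r - Real.log (1 - r))) :=
      mul_le_mul_of_nonneg_right (by linarith) (by linarith)
    linarith)
  have hq' := hmain q hq0 h1q heq.symm (by
    have : (m * r - k) * ((Real.log q - Real.log (1 - q)) - (Real.log r - Real.log (1 - r))) ≤ 0 :=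
      mul_nonpos_of_nonneg_of_nonpos (by linarith) (by linarith)
    linarith)
  refine ⟨k, by omega, α, hα0, hα1, ?_⟩
  refine le_trans ?_ (mul_le_mul_of_nonneg_left (le_min hp' hq') (by positivity))
  have hs : Real.exp (-4) / √(m * p) ≤ Real.exp (-4) / √(m * r) := by
    apply div_le_div_of_nonneg_left (Real.exp_pos _).le (Real.sqrt_pos.2 (by positivity))
    exact Real.sqrt_le_sqrt (by nlinarith)
  have hpos := (bernoulliAffinity_pos (α := α) hp0 hp1 hq0 (by linarith))
  calc _ = (Real.exp (-4) / √(m * p)) * ((ε / ω) * bernoulliAffinity α p q ^ m) := by ring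
    _ ≤ _ := mul_le_mul_of_nonneg_right (hs.trans hmode) (by positivity)
    _ = _ := by ring

/-! ### Chernoff information of Bernoulli products and binomials -/

/-- The mass function of `Bern(p)` on `Bool`. -/
def bernoulliMass (p : ℝ) (b : Bool) : ℝ := if b then p else 1 - p

theorem bernoulliMass_nonneg (p : unitInterval) (b : Bool) : 0 ≤ bernoulliMass p b := by
  cases b
  · simpa [bernoulliMass] using p.2.2
  · simpa [bernoulliMass] using p.2.1

theorem sum_bernoulliMass (p : ℝ) : ∑ b, bernoulliMass p b = 1 := by
  simp [bernoulliMass]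

theorem pi_bernoulliMeasure_real_singleton {ι : Type*} [Fintype ι] (p : ι → unitInterval)
    (x : ι → Bool) :
    (Measure.pi fun j => bernoulliMeasure true false (p j)).real {x} =
      ∏ j, bernoulliMass (p j) (x j) := by
  rw [measureReal_def, Measure.pi_singleton, ENNReal.toReal_prod]
  refine Finset.prod_congr rfl fun j _ => ?_
  change (bernoulliMeasure true false (p j)).real {x j} = _
  cases x j <;> simp [bernoulliMass]

theorem chernoffInfo_comm {X : Type*} [MeasurableSpace X] (μ ν : Measure X) :
    chernoffInfo μ ν = chernoffInfo ν μ := by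
  have hmem : ∀ α : Set.Ioo (0 : ℝ) 1, (1 - (α : ℝ)) ∈ Set.Ioo (0 : ℝ) 1 := fun α =>
    ⟨by linarith [α.2.2], by linarith [α.2.1]⟩
  let e : Set.Ioo (0 : ℝ) 1 → Set.Ioo (0 : ℝ) 1 := fun α => ⟨1 - α, hmem α⟩
  refine Function.Surjective.iSup_congr e (fun α => ⟨e α, Subtype.ext (by simp [e])⟩) fun α => ?_
  simp only [chernoffDiv, e, sub_sub_cancel]
  congr 2
  exact tsum_congr fun x => mul_comm _ _

theorem chernoffDiv_bernoulliVector {n : ℕ} (α : ℝ) (p q : Fin n → unitInterval) :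
    chernoffDiv α (SBM.bernoulliVector p) (SBM.bernoulliVector q) =
      -Real.log (∏ j, bernoulliAffinity α (p j) (q j)) := by
  rw [chernoffDiv, tsum_fintype]
  congr 2
  simp only [SBM.bernoulliVector, pi_bernoulliMeasure_real_singleton]
  have : ∀ j, bernoulliAffinity α (p j) (q j) =
      ∑ b, bernoulliMass (p j) b ^ (1 - α) * bernoulliMass (q j) b ^ α := by
    intro j
    simp [bernoulliMass, bernoulliAffinity]
  simp only [this, Fintype.prod_sum]
  refine Finset.sum_congr rfl fun x _ => ?_
  rw [Finset.prod_mul_distrib, Real.finsetProd_rpow _ _ fun j _ => bernoulliMass_nonneg _ _,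
    Real.finsetProd_rpow _ _ fun j _ => bernoulliMass_nonneg _ _]

/-- The binomial theorem read backwards. No range for α is needed: where the binomial coefficient
vanishes, one of the exponents α and 1 - α is nonzero. -/
theorem chernoffDiv_binomial {p q : unitInterval} (hp0 : 0 < (p : ℝ)) (hp1 : (p : ℝ) < 1)
    (hq0 : 0 < (q : ℝ)) (hq1 : (q : ℝ) < 1) (α : ℝ) (m : ℕ) :
    chernoffDiv α (binomial m p) (binomial m q) = -Real.log (bernoulliAffinity α p q ^ m) := by
  have h1p : (0 : ℝ) < 1 - p := by linarith
  have h1q : (0 : ℝ) < 1 - q := by linarith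
  rw [chernoffDiv, bernoulliAffinity, add_pow, tsum_eq_sum (s := Finset.range (m + 1))]
  · congr 2
    refine Finset.sum_congr rfl fun k _ => ?_
    rw [binomial_real_singleton, binomial_real_singleton, Real.mul_rpow (by positivity)
      (by positivity), Real.mul_rpow (by positivity) (by positivity),
      Real.mul_rpow (by positivity) (by positivity), Real.mul_rpow (by positivity) (by positivity)]
    have hc : (m.choose k : ℝ) ^ (1 - α) * (m.choose k : ℝ) ^ α = m.choose k := by
      rcases Nat.eq_zero_or_pos (m.choose k) with h | h
      · rw [h]
        rcases eq_or_ne α 0 with h0 | h0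
        · simp [h0]
        · simp [Real.zero_rpow h0]
      · rw [← Real.rpow_add (by exact_mod_cast h)]; simp
    have hcomm : ∀ (x s : ℝ) (i : ℕ), 0 ≤ x → (x ^ i) ^ s = (x ^ s) ^ i := by
      intro x s i hx
      rw [← Real.rpow_natCast, ← Real.rpow_natCast, ← Real.rpow_mul hx, ← Real.rpow_mul hx,
        mul_comm]
    rw [hcomm _ _ _ hp0.le, hcomm _ _ _ hq0.le, hcomm _ _ _ h1p.le, hcomm _ _ _ h1q.le,
      mul_pow, mul_pow]
    nth_rewrite 3 [← hc]
    ring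
  · intro k hk
    have : m < k := by simpa using hk
    rw [binomial_real_singleton, binomial_real_singleton, Nat.choose_eq_zero_of_lt this]
    rcases eq_or_ne α 0 with h0 | h0
    · simp [h0]
    · simp [Real.zero_rpow h0]

/-- A bound uniform in α, which makes the divergences bounded above, so that the real supremum in
`chernoffInfo` is not a default value. -/
theorem mul_le_bernoulliAffinity {α p q : ℝ} (hα0 : 0 < α) (hα1 : α < 1) (hp0 : 0 < p)
    (hp1 : p < 1) (hq0 : 0 < q) (hq1 : q < 1) : (1 - p) * (1 - q) ≤ bernoulliAffinity α p q := by
  have h1 : (1 - p) ^ (1 : ℝ) ≤ (1 - p) ^ (1 - α) :=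
    Real.rpow_le_rpow_of_exponent_ge (by linarith) (by linarith) (by linarith)
  have h2 : (1 - q) ^ (1 : ℝ) ≤ (1 - q) ^ α :=
    Real.rpow_le_rpow_of_exponent_ge (by linarith) (by linarith) (by linarith)
  rw [Real.rpow_one] at h1 h2
  have h3 := mul_le_mul h1 h2 (by linarith) (Real.rpow_nonneg (by linarith) _)
  have h4 : 0 ≤ p ^ (1 - α) * q ^ α := by positivity
  unfold bernoulliAffinity
  linarith

/-- The supremum dominates each of its members, so the equalizing α can be used without proving it
optimal. -/
theorem exp_neg_chernoffInfo_binomial_le {p q : unitInterval} (hp0 : 0 < (p : ℝ))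
    (hp1 : (p : ℝ) < 1) (hq0 : 0 < (q : ℝ)) (hq1 : (q : ℝ) < 1) {α : ℝ} (hα0 : 0 < α)
    (hα1 : α < 1) (m : ℕ) :
    Real.exp (-chernoffInfo (binomial m p) (binomial m q)) ≤ bernoulliAffinity α p q ^ m := by
  have hpos : 0 < bernoulliAffinity α p q ^ m := pow_pos (bernoulliAffinity_pos hp0 hp1 hq0 hq1) m
  rw [← Real.le_log_iff_exp_le hpos, neg_le, ← chernoffDiv_binomial hp0 hp1 hq0 hq1]
  have hc : (0 : ℝ) < (1 - p) * (1 - q) := mul_pos (by linarith) (by linarith)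
  refine le_ciSup (f := fun a : Set.Ioo (0 : ℝ) 1 =>
    chernoffDiv (a : ℝ) (binomial m p) (binomial m q)) ⟨-Real.log (((1 - p) * (1 - q) : ℝ) ^ m), ?_⟩
    (⟨α, hα0, hα1⟩ : Set.Ioo (0 : ℝ) 1)
  rintro _ ⟨a, rfl⟩
  simp only [chernoffDiv_binomial hp0 hp1 hq0 hq1, neg_le_neg_iff]
  exact Real.log_le_log (pow_pos hc m) (pow_le_pow_left₀ hc.le
    (mul_le_bernoulliAffinity a.2.1 a.2.2 hp0 hp1 hq0 hq1) m)

/-- Affinities are at most 1 and multiply, so discarding coordinates can only lower the Chernoff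
information. -/
theorem chernoffInfo_binomial_le_bernoulliVector {n m : ℕ} {p q : unitInterval}
    {u v : Fin n → unitInterval} (hu : ∀ j, 0 < (u j : ℝ) ∧ (u j : ℝ) < 1)
    (hv : ∀ j, 0 < (v j : ℝ) ∧ (v j : ℝ) < 1) (hp : 0 < (p : ℝ) ∧ (p : ℝ) < 1)
    (hq : 0 < (q : ℝ) ∧ (q : ℝ) < 1) {T : Finset (Fin n)} (hT : m ≤ T.card)
    (hTu : ∀ j ∈ T, u j = p) (hTv : ∀ j ∈ T, v j = q) :
    chernoffInfo (binomial m p) (binomial m q) ≤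
      chernoffInfo (SBM.bernoulliVector u) (SBM.bernoulliVector v) := by
  have : Nonempty (Set.Ioo (0 : ℝ) 1) := ⟨⟨1 / 2, by norm_num, by norm_num⟩⟩
  refine ciSup_mono ⟨-Real.log (∏ j, ((1 - u j) * (1 - v j) : ℝ)), ?_⟩ fun α => ?_
  · rintro _ ⟨a, rfl⟩
    simp only [chernoffDiv_bernoulliVector, neg_le_neg_iff]
    have hc : ∀ j, (0 : ℝ) < (1 - u j) * (1 - v j) := fun j =>
      mul_pos (by linarith [hu j]) (by linarith [hv j])
    exact Real.log_le_log (Finset.prod_pos fun j _ => hc j) (Finset.prod_le_prod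
      (fun j _ => (hc j).le) fun j _ =>
        mul_le_bernoulliAffinity a.2.1 a.2.2 (hu j).1 (hu j).2 (hv j).1 (hv j).2)
  · rw [chernoffDiv_binomial hp.1 hp.2 hq.1 hq.2, chernoffDiv_bernoulliVector, neg_le_neg_iff]
    have hpos : ∀ j, 0 < bernoulliAffinity α (u j) (v j) := fun j =>
      bernoulliAffinity_pos (hu j).1 (hu j).2 (hv j).1 (hv j).2
    have hle : ∀ j, bernoulliAffinity α (u j) (v j) ≤ 1 := fun j =>
      bernoulliAffinity_le_one α.2.1 α.2.2 (hu j).1 (hu j).2 (hv j).1 (hv j).2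
    refine Real.log_le_log (Finset.prod_pos fun j _ => hpos j) ?_
    have h0 := (bernoulliAffinity_pos (α := α) hp.1 hp.2 hq.1 hq.2)
    have h1 := bernoulliAffinity_le_one α.2.1 α.2.2 hp.1 hp.2 hq.1 hq.2
    calc ∏ j, bernoulliAffinity α (u j) (v j)
        ≤ ∏ j ∈ T, bernoulliAffinity α (u j) (v j) := by
          rw [← Finset.prod_mul_prod_compl T]
          exact mul_le_of_le_one_right (Finset.prod_nonneg fun j _ => (hpos j).le)
            (Finset.prod_le_one (fun j _ => (hpos j).le) fun j _ => hle j)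
      _ = bernoulliAffinity α p q ^ T.card := by
          rw [← Finset.prod_const]
          exact Finset.prod_congr rfl fun j hj => by rw [hTu j hj, hTv j hj]
      _ ≤ _ := pow_le_pow_of_le_one h0.le h1 hT

/-! ### Overlap of two Bernoulli products -/

theorem sum_prod_bernoulliMass {ι : Type*} [Fintype ι] [DecidableEq ι] (f : ι → ℝ) :
    ∑ x : ι → Bool, ∏ e, bernoulliMass (f e) (x e) = 1 := by
  rw [← Fintype.prod_sum fun e b => bernoulliMass (f e) b]
  exact Finset.prod_eq_one fun e _ => sum_bernoulliMass (f e)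

/-- Two product laws on `{0, 1}^ι` that are `Bern(p)`, respectively `Bern(q)`, on the coordinates in
`E` and agree elsewhere overlap at least as much as `Bin(|E|, p)` and `Bin(|E|, q)` do at `k`. -/
theorem overlap_prod_bernoulliMass {ι : Type*} [Fintype ι] [DecidableEq ι] (E : Finset ι)
    (f g : ι → unitInterval) (p q : unitInterval) (hfE : ∀ e ∈ E, f e = p) (hgE : ∀ e ∈ E, g e = q)
    (hfg : ∀ e ∉ E, f e = g e) (k : ℕ) :
    (E.card.choose k : ℝ) * min ((p : ℝ) ^ k * (1 - p) ^ (E.card - k))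
        ((q : ℝ) ^ k * (1 - q) ^ (E.card - k)) ≤
      ∑ x : ι → Bool, min (∏ e, bernoulliMass (f e) (x e)) (∏ e, bernoulliMass (g e) (x e)) := by
  -- `Fintype.piFinset (t A)` is the cylinder of configurations equal to the indicator of A on E.
  -- For |A| = k these cylinders are disjoint, and each contributes exactly M.
  set t : Finset ι → ι → Finset Bool := fun A e =>
    if e ∈ E then {decide (e ∈ A)} else Finset.univ with ht
  set M := min ((p : ℝ) ^ k * (1 - p) ^ (E.card - k)) ((q : ℝ) ^ k * (1 - q) ^ (E.card - k))
    with hM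
  have hmem : ∀ A x, x ∈ Fintype.piFinset (t A) → ∀ e ∈ E, x e = decide (e ∈ A) := by
    intro A x hx e he
    have := Fintype.mem_piFinset.1 hx e
    simpa [ht, he] using this
  have hprodE : ∀ (h : ι → unitInterval) (s : unitInterval), (∀ e ∈ E, h e = s) →
      ∀ A ∈ E.powersetCard k, ∀ x ∈ Fintype.piFinset (t A),
        ∏ e ∈ E, bernoulliMass (h e) (x e) = (s : ℝ) ^ k * (1 - s) ^ (E.card - k) := by
    intro h s hs A hA x hx
    obtain ⟨hAE, hAk⟩ := Finset.mem_powersetCard.1 hA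
    have : ∀ e ∈ E, bernoulliMass (h e) (x e) = if e ∈ A then (s : ℝ) else 1 - s := by
      intro e he
      rw [hs e he, hmem A x hx e he]
      simp [bernoulliMass]
    rw [Finset.prod_congr rfl this, Finset.prod_ite, Finset.prod_const, Finset.prod_const]
    congr 2
    · rw [← hAk, Finset.filter_mem_eq_inter, Finset.inter_eq_right.2 hAE]
    · rw [← hAk, ← Finset.card_sdiff_of_subset hAE]
      congr 1
      ext e; simp
  have hpoint : ∀ A ∈ E.powersetCard k, ∀ x ∈ Fintype.piFinset (t A),
      min (∏ e, bernoulliMass (f e) (x e)) (∏ e, bernoulliMass (g e) (x e)) =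
        M * ∏ e ∈ Eᶜ, bernoulliMass (f e) (x e) := by
    intro A hA x hx
    have hg : ∏ e ∈ Eᶜ, bernoulliMass (g e) (x e) = ∏ e ∈ Eᶜ, bernoulliMass (f e) (x e) :=
      Finset.prod_congr rfl fun e he => by rw [hfg e (Finset.mem_compl.1 he)]
    rw [← Finset.prod_mul_prod_compl E, ← Finset.prod_mul_prod_compl E, hprodE f p hfE A hA x hx,
      hprodE g q hgE A hA x hx, hg, hM, min_mul_of_nonneg]
    exact Finset.prod_nonneg fun e _ => bernoulliMass_nonneg _ _
  have hsum : ∀ A, ∑ x ∈ Fintype.piFinset (t A), ∏ e ∈ Eᶜ, bernoulliMass (f e) (x e) = 1 := by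
    intro A
    have : ∀ x : ι → Bool, ∏ e ∈ Eᶜ, bernoulliMass (f e) (x e) =
        ∏ e, if e ∈ E then 1 else bernoulliMass (f e) (x e) := by
      intro x
      rw [← Finset.prod_mul_prod_compl E (fun e => if e ∈ E then 1 else bernoulliMass (f e) (x e)),
        Finset.prod_congr rfl (g := fun _ => (1 : ℝ)) (fun e he => if_pos he), Finset.prod_const_one,
        one_mul]
      exact Finset.prod_congr rfl fun e he => (if_neg (Finset.mem_compl.1 he)).symm
    simp only [this]
    rw [← Finset.prod_univ_sum (t A) (fun e b => if e ∈ E then 1 else bernoulliMass (f e) b)]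
    refine Finset.prod_eq_one fun e _ => ?_
    by_cases he : e ∈ E
    · simp [ht, he]
    · simp only [ht, he, if_false]
      exact sum_bernoulliMass _
  have hdisj : (↑(E.powersetCard k) : Set (Finset ι)).PairwiseDisjoint
      fun A => Fintype.piFinset (t A) := by
    intro A hA B hB hAB
    refine Finset.disjoint_left.2 fun x hxA hxB => hAB ?_
    have hA' := (Finset.mem_powersetCard.1 (Finset.mem_coe.1 hA)).1
    have hB' := (Finset.mem_powersetCard.1 (Finset.mem_coe.1 hB)).1
    ext e
    by_cases he : e ∈ E
    · have := (hmem A x hxA e he).symm.trans (hmem B x hxB e he)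
      simpa using this
    · exact ⟨fun h => absurd (hA' h) he, fun h => absurd (hB' h) he⟩
  calc (E.card.choose k : ℝ) * M
      = ∑ A ∈ E.powersetCard k, ∑ x ∈ Fintype.piFinset (t A),
          min (∏ e, bernoulliMass (f e) (x e)) (∏ e, bernoulliMass (g e) (x e)) := by
        rw [Finset.sum_congr rfl (g := fun _ => M), Finset.sum_const, Finset.card_powersetCard,
          nsmul_eq_mul]
        intro A hA
        rw [Finset.sum_congr rfl (hpoint A hA), ← Finset.mul_sum, hsum, mul_one]
    _ = ∑ x ∈ (E.powersetCard k).biUnion fun A => Fintype.piFinset (t A),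
          min (∏ e, bernoulliMass (f e) (x e)) (∏ e, bernoulliMass (g e) (x e)) :=
        (Finset.sum_biUnion hdisj).symm
    _ ≤ _ := Finset.sum_le_sum_of_subset_of_nonneg (Finset.subset_univ _) fun x _ _ =>
        le_min (Finset.prod_nonneg fun e _ => bernoulliMass_nonneg _ _)
          (Finset.prod_nonneg fun e _ => bernoulliMass_nonneg _ _)

/-! ### Risk, relabellings and the reduction to two-point tests -/

namespace SBM

theorem risk_eq_sum {n K : ℕ} (zhat : Estimator n K)
    (θ : (Fin n → Fin K) × Matrix (Fin K) (Fin K) unitInterval) :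
    risk zhat θ = ∑ x : LowerPairs n → Bool,
      (∏ e : LowerPairs n, bernoulliMass (θ.2 (θ.1 e.1.1) (θ.1 e.1.2)) (x e)) *
        ∑ y, (zhat (symmMatrix x) y).toReal * mis y θ.1 := by
  rw [risk, law, integral_map (Measurable.of_discrete).aemeasurable
    (Measurable.of_discrete).aestronglyMeasurable, integral_fintype .of_finite]
  refine Finset.sum_congr rfl fun x _ => ?_
  rw [pi_bernoulliMeasure_real_singleton, smul_eq_mul]

theorem mis_le_one {n K : ℕ} (y z : Fin n → Fin K) : mis y z ≤ 1 := by
  refine (ciInf_le (Set.finite_range _).bddBelow (Equiv.refl _)).trans ?_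
  have h : ∑ i, (if (Equiv.refl (Fin K)) (y i) ≠ z i then (1 : ℝ) else 0) ≤ ∑ _i : Fin n, 1 :=
    Finset.sum_le_sum fun i _ => by split_ifs <;> norm_num
  rw [Finset.sum_const, Finset.card_univ, Fintype.card_fin, nsmul_eq_mul, mul_one] at h
  rcases Nat.eq_zero_or_pos n with h0 | h0
  · subst h0; simp
  · rw [one_div, inv_mul_le_iff₀ (by exact_mod_cast h0)]
    linarith

theorem sum_pmf_toReal {Y : Type*} [Fintype Y] (φ : PMF Y) : ∑ y, (φ y).toReal = 1 := by
  rw [← ENNReal.toReal_sum fun y _ => φ.apply_ne_top y, ← tsum_fintype (L := .unconditional _),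
    φ.tsum_coe, ENNReal.toReal_one]

theorem risk_le_one {n K : ℕ} (zhat : Estimator n K)
    (θ : (Fin n → Fin K) × Matrix (Fin K) (Fin K) unitInterval) : risk zhat θ ≤ 1 := by
  rw [risk_eq_sum, ← sum_prod_bernoulliMass
    fun e : LowerPairs n => ((θ.2 (θ.1 e.1.1) (θ.1 e.1.2) : unitInterval) : ℝ)]
  refine Finset.sum_le_sum fun x _ => mul_le_of_le_one_right
    (Finset.prod_nonneg fun e _ => bernoulliMass_nonneg _ _) ?_
  rw [← sum_pmf_toReal (zhat (symmMatrix x))]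
  exact Finset.sum_le_sum fun y _ =>
    mul_le_of_le_one_right ENNReal.toReal_nonneg (mis_le_one _ _)

/-- If all labellings `z σ` are close to `z σ₀`, whose communities are large, then the labels of any
estimate `y` can be matched with the true ones by a permutation that does not depend on `σ`. -/
theorem exists_perm_sum_le_mis {n K : ℕ} {ι : Type*} (z : ι → Fin n → Fin K) (σ₀ : ι)
    (S : Finset (Fin n)) (hz : ∀ σ, ∀ i ∉ S, z σ i = z σ₀ i)
    (hsize : ∀ k, 4 * S.card ≤ communitySize (z σ₀) k) (y : Fin n → Fin K) :
    ∃ π : Equiv.Perm (Fin K), ∀ σ,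
      (1 / (n : ℝ)) * ∑ i ∈ S, (if π (y i) ≠ z σ i then (1 : ℝ) else 0) ≤ mis y (z σ) := by
  set d : Equiv.Perm (Fin K) → (Fin n → Fin K) → Finset (Fin n) :=
    fun π w => Finset.univ.filter fun i => π (y i) ≠ w i with hd
  -- π₀ is the best relabelling for the reference labelling. A competitor with at least |S| errors
  -- loses trivially; one with fewer must equal π₀.
  obtain ⟨π₀, hπ₀⟩ := Finite.exists_min fun π => (d π (z σ₀)).card
  refine ⟨π₀, fun σ => le_ciInf fun π => mul_le_mul_of_nonneg_left ?_ (by positivity)⟩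
  rcases lt_or_ge (d π (z σ)).card S.card with hlt | hge
  · have hdist : d π (z σ₀) ⊆ d π (z σ) ∪ S := by
      intro i hi
      by_cases hiS : i ∈ S
      · exact Finset.mem_union_right _ hiS
      · refine Finset.mem_union_left _ ?_
        simp only [hd, Finset.mem_filter, Finset.mem_univ, true_and] at hi ⊢
        rwa [hz σ i hiS]
    have h1 : (d π (z σ₀)).card < 2 * S.card :=
      ((Finset.card_le_card hdist).trans (Finset.card_union_le _ _)).trans_lt (by omega)
    have h2 : (d π₀ (z σ₀)).card < 2 * S.card := (hπ₀ π).trans_lt h1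
    have hπ : π = π₀ := by
      ext1 a
      by_contra hne
      -- If π and π₀ differ at a, no vertex of community π a is right under both, yet they make
      -- fewer than 4|S| errors in total.
      have hsub : (Finset.univ.filter fun i => z σ₀ i = π a) ⊆ d π (z σ₀) ∪ d π₀ (z σ₀) := by
        intro i hi
        simp only [hd, Finset.mem_union, Finset.mem_filter, Finset.mem_univ, true_and] at hi ⊢
        by_contra! hcon
        rw [hi] at hcon
        have hya : y i = a := π.injective hcon.1
        exact hne (by rw [← hcon.2, hya])
      have := (Finset.card_le_card hsub).trans (Finset.card_union_le _ _)
      have h3 := hsize (π a)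
      rw [communitySize] at h3
      omega
    rw [hπ]
    exact Finset.sum_le_sum_of_subset_of_nonneg (Finset.subset_univ _) fun i _ _ => by
      split_ifs <;> norm_num
  · have hcard : ∑ i, (if π (y i) ≠ z σ i then (1 : ℝ) else 0) = (d π (z σ)).card :=
      Finset.sum_boole _ _
    rw [hcard]
    refine (Finset.sum_le_sum (g := fun _ => (1 : ℝ)) fun i _ => by
      split_ifs <;> norm_num).trans ?_
    rw [Finset.sum_const, nsmul_eq_mul, mul_one]
    exact_mod_cast hge

/-- Flip one bit. -/
def flipAt {n : ℕ} (i : Fin n) (σ : Fin n → Bool) : Fin n → Bool := Function.update σ i (!σ i)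

theorem flipAt_involutive {n : ℕ} (i : Fin n) : Function.Involutive (flipAt i) := by
  intro σ
  simp [flipAt]

/-- Assouad-type reduction to two-point testing problems, one for each uncertain vertex. -/
theorem exists_risk_ge {n K : ℕ} (z : (Fin n → Bool) → Fin n → Fin K)
    (P : Matrix (Fin K) (Fin K) unitInterval) (S : Finset (Fin n)) (V : ℝ)
    (hmis : ∀ y, ∃ π : Equiv.Perm (Fin K), ∀ σ,
      (1 / (n : ℝ)) * ∑ i ∈ S, (if π (y i) ≠ z σ i then (1 : ℝ) else 0) ≤ mis y (z σ))
    (hne : ∀ i ∈ S, ∀ σ, z σ i ≠ z (flipAt i σ) i)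
    (hV : ∀ i ∈ S, ∀ σ, V ≤ ∑ x : LowerPairs n → Bool,
      min (∏ e : LowerPairs n, bernoulliMass (P (z σ e.1.1) (z σ e.1.2)) (x e))
        (∏ e : LowerPairs n,
          bernoulliMass (P (z (flipAt i σ) e.1.1) (z (flipAt i σ) e.1.2)) (x e)))
    (zhat : Estimator n K) :
    ∃ σ, (1 / (n : ℝ)) * (S.card * (V / 2)) ≤ risk zhat (z σ, P) := by
  -- As π depends on y alone, π y (y i) is a legitimate estimate of label i, and it cannot be right
  -- for both σ and its flip.
  choose π hπ using hmis
  set w : (Fin n → Bool) → (LowerPairs n → Bool) → ℝ := fun σ x =>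
    ∏ e : LowerPairs n, bernoulliMass (P (z σ e.1.1) (z σ e.1.2)) (x e) with hw
  have hw0 : ∀ σ x, 0 ≤ w σ x := fun σ x => Finset.prod_nonneg fun e _ => bernoulliMass_nonneg _ _
  set err : (Fin n → Bool) → Fin n → (Fin n → Fin K) → ℝ := fun σ i y =>
    if π y (y i) ≠ z σ i then (1 : ℝ) else 0 with herr
  set G : (Fin n → Bool) → Fin n → ℝ := fun σ i =>
    ∑ x, w σ x * ∑ y, (zhat (symmMatrix x) y).toReal * err σ i y with hG
  have hrisk : ∀ σ, (1 / (n : ℝ)) * ∑ i ∈ S, G σ i ≤ risk zhat (z σ, P) := by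
    intro σ
    rw [risk_eq_sum]
    have : (1 / (n : ℝ)) * ∑ i ∈ S, G σ i = ∑ x, w σ x *
        ∑ y, (zhat (symmMatrix x) y).toReal * ((1 / (n : ℝ)) * ∑ i ∈ S, err σ i y) := by
      simp only [hG, Finset.mul_sum]
      rw [Finset.sum_comm]
      refine Finset.sum_congr rfl fun x _ => ?_
      rw [Finset.sum_comm]
      refine Finset.sum_congr rfl fun y _ => Finset.sum_congr rfl fun i _ => by ring
    rw [this]
    exact Finset.sum_le_sum fun x _ => mul_le_mul_of_nonneg_left (Finset.sum_le_sum fun y _ =>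
      mul_le_mul_of_nonneg_left (hπ y σ) ENNReal.toReal_nonneg) (hw0 σ x)
  have hpair : ∀ i ∈ S, ∀ σ, V ≤ G σ i + G (flipAt i σ) i := by
    intro i hi σ
    refine (hV i hi σ).trans ?_
    simp only [hG, ← Finset.sum_add_distrib]
    refine Finset.sum_le_sum fun x _ => ?_
    change min (w σ x) (w (flipAt i σ) x) ≤ _
    rw [← mul_one (min _ _), ← sum_pmf_toReal (zhat (symmMatrix x)), Finset.mul_sum,
      Finset.mul_sum, Finset.mul_sum, ← Finset.sum_add_distrib]
    refine Finset.sum_le_sum fun y _ => ?_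
    have ht : 0 ≤ (zhat (symmMatrix x) y).toReal := ENNReal.toReal_nonneg
    by_cases hcase : π y (y i) = z σ i
    · have h2 : err (flipAt i σ) i y = 1 := if_pos (by rw [hcase]; exact hne i hi σ)
      have h1 : err σ i y = 0 := if_neg (not_not.2 hcase)
      rw [h1, h2, mul_zero, mul_zero, zero_add, mul_one]
      exact mul_le_mul_of_nonneg_right (min_le_right _ _) ht
    · have h1 : err σ i y = 1 := if_pos hcase
      have h2 : 0 ≤ err (flipAt i σ) i y := by simp only [herr]; split_ifs <;> norm_num
      rw [h1, mul_one]
      have := mul_le_mul_of_nonneg_right (min_le_left (w σ x) (w (flipAt i σ) x)) ht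
      have h3 := mul_nonneg (hw0 (flipAt i σ) x) (mul_nonneg ht h2)
      linarith
  have hsumG : ∀ i ∈ S, ∑ _σ : Fin n → Bool, V / 2 ≤ ∑ σ, G σ i := by
    intro i hi
    -- Flipping permutes the cube, so the pairwise bound becomes an average bound of V/2 per
    -- uncertain vertex.
    have h1 : ∑ σ, G (flipAt i σ) i = ∑ σ, G σ i :=
      Equiv.sum_comp (flipAt_involutive i).toPerm fun σ => G σ i
    have h2 := Finset.sum_le_sum fun σ (_ : σ ∈ Finset.univ) => hpair i hi σ
    rw [Finset.sum_add_distrib, h1] at h2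
    rw [← Finset.sum_div]
    linarith
  obtain ⟨σ, -, hσ⟩ := Finset.exists_le_of_sum_le (s := (Finset.univ : Finset (Fin n → Bool)))
    (f := fun _ => S.card * (V / 2)) (g := fun σ => ∑ i ∈ S, G σ i) Finset.univ_nonempty (by
      rw [Finset.sum_comm (s := Finset.univ)]
      have := Finset.sum_le_sum hsumG
      rw [Finset.sum_const, nsmul_eq_mul, Finset.mul_sum] at this
      exact this)
  exact ⟨σ, (mul_le_mul_of_nonneg_left hσ (by positivity)).trans (hrisk σ)⟩

/-! ### The least favourable family -/

/-- The half-graph connectivity matrix: `p` on and below the antidiagonal shifted by one, `q`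
above it. Consecutive rows differ in one entry. -/
def halfGraphMatrix (K : ℕ) (p q : unitInterval) : Matrix (Fin K) (Fin K) unitInterval :=
  fun k l => if K ≤ (k : ℕ) + l then p else q

/-- Consecutive blocks of length `m`, labelled `0, …, K - 1`; the remaining vertices get label `0`,
and among the first `s` vertices those with `σ i = true` get label `1`. -/
def blockLabel {n K : ℕ} (hK : 3 ≤ K) (m s : ℕ) (σ : Fin n → Bool) (i : Fin n) : Fin K :=
  if (i : ℕ) < s ∧ σ i = true then ⟨1, by omega⟩
  else if h : (i : ℕ) / m < K then ⟨i / m, h⟩ else ⟨0, by omega⟩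

theorem card_filter_fin_interval (n a b : ℕ) :
    (Finset.univ.filter fun i : Fin n => a ≤ (i : ℕ) ∧ (i : ℕ) < b).card = min b n - a := by
  rw [← Nat.card_Ico, ← Finset.card_map Fin.valEmbedding]
  congr 1
  ext j
  simp only [Finset.mem_map, Finset.mem_filter, Finset.mem_univ, true_and, Fin.valEmbedding_apply,
    Finset.mem_Ico, lt_min_iff]
  constructor
  · rintro ⟨i, hi, rfl⟩
    exact ⟨hi.1, hi.2, i.2⟩
  · rintro ⟨h1, h2, h3⟩
    exact ⟨⟨j, h3⟩, ⟨h1, h2⟩, rfl⟩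

section blockLabel

variable {n K m s : ℕ} (hK : 3 ≤ K)

theorem blockLabel_eq_of_mem_block (σ : Fin n → Bool) {i : Fin n} {k : Fin K} (hi : s ≤ (i : ℕ))
    (h1 : (k : ℕ) * m ≤ i) (h2 : (i : ℕ) < (k + 1) * m) : blockLabel hK m s σ i = k := by
  have hd : (i : ℕ) / m = k := Nat.div_eq_of_lt_le h1 h2
  rw [blockLabel, if_neg (by omega), dif_pos (by rw [hd]; exact k.2)]
  exact Fin.ext hd

theorem blockLabel_of_lt (hsm : s ≤ m) (σ : Fin n → Bool) {i : Fin n} (hi : (i : ℕ) < s) :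
    ((blockLabel hK m s σ i : Fin K) : ℕ) = if σ i = true then 1 else 0 := by
  have hd : (i : ℕ) / m = 0 := Nat.div_eq_of_lt (by omega)
  by_cases h : σ i = true
  · rw [blockLabel, if_pos ⟨hi, h⟩, if_pos h]
  · rw [blockLabel, if_neg (by tauto), dif_pos (by omega), if_neg h]
    exact hd

theorem blockLabel_congr {σ τ : Fin n → Bool} {i : Fin n} (h : σ i = τ i ∨ s ≤ (i : ℕ)) :
    (blockLabel hK m s σ i : Fin K) = blockLabel hK m s τ i := by
  rcases h with h | h
  · simp only [blockLabel, h]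
  · have h' : ¬ (i : ℕ) < s := by omega
    simp only [blockLabel, h', false_and, if_false]

theorem mem_block_of_blockLabel_eq (hm : 0 < m) (σ : Fin n → Bool) {i : Fin n} {k : Fin K}
    (h : blockLabel hK m s σ i = k) :
    ((k : ℕ) * m ≤ i ∧ (i : ℕ) < (k + 1) * m) ∨ (i : ℕ) < s ∧ (k : ℕ) = 1 ∨
      K * m ≤ i ∧ (k : ℕ) = 0 := by
  subst h
  by_cases h1 : (i : ℕ) < s ∧ σ i = true
  · exact Or.inr (Or.inl ⟨h1.1, by rw [blockLabel, if_pos h1]⟩)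
  · by_cases h2 : (i : ℕ) / m < K
    · left
      rw [blockLabel, if_neg h1, dif_pos h2]
      exact ⟨Nat.div_mul_le_self _ _, by
        rw [← Nat.div_lt_iff_lt_mul hm]; exact Nat.lt_succ_self _⟩
    · right; right
      refine ⟨?_, by rw [blockLabel, if_neg h1, dif_neg h2]⟩
      exact (Nat.le_div_iff_mul_le hm).1 (not_lt.1 h2)

theorem le_communitySize_blockLabel (hn : K * m ≤ n) (σ : Fin n → Bool) (k : Fin K) :
    m - s ≤ communitySize (blockLabel hK m s σ) k := by
  have hk : ((k : ℕ) + 1) * m ≤ K * m := Nat.mul_le_mul_right m k.2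
  have h := card_filter_fin_interval n (k * m + s) ((k + 1) * m)
  rw [min_eq_left (by omega), show ((k : ℕ) + 1) * m - (k * m + s) = m - s by
    rw [add_mul]; omega] at h
  refine h.ge.trans (Finset.card_le_card fun i hi => ?_)
  simp only [Finset.mem_filter, Finset.mem_univ, true_and] at hi ⊢
  exact blockLabel_eq_of_mem_block hK σ (by omega) (by omega) hi.2

/-- Only block 0 contains uncertain vertices, so the other communities never lose any. The Chernoff
constraint needs the full m. -/
theorem le_communitySize_blockLabel_of_pos (hsm : s ≤ m) (hn : K * m ≤ n) (σ : Fin n → Bool)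
    (k : Fin K) (hk0 : 1 ≤ (k : ℕ)) : m ≤ communitySize (blockLabel hK m s σ) k := by
  have hk : ((k : ℕ) + 1) * m ≤ K * m := Nat.mul_le_mul_right m k.2
  have hk' : 1 * m ≤ (k : ℕ) * m := Nat.mul_le_mul_right m hk0
  have h := card_filter_fin_interval n (k * m) ((k + 1) * m)
  rw [min_eq_left (by omega), show ((k : ℕ) + 1) * m - k * m = m by
    rw [add_mul]; omega] at h
  refine h.ge.trans (Finset.card_le_card fun i hi => ?_)
  simp only [Finset.mem_filter, Finset.mem_univ, true_and] at hi ⊢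
  exact blockLabel_eq_of_mem_block hK σ (by omega) hi.1 hi.2

theorem communitySize_blockLabel_le (hm : 0 < m) (hn : K * m ≤ n) (σ : Fin n → Bool) (k : Fin K) :
    communitySize (blockLabel hK m s σ) k ≤ m + s + (n - K * m) := by
  have hk : ((k : ℕ) + 1) * m ≤ K * m := Nat.mul_le_mul_right m k.2
  have h1 := card_filter_fin_interval n (k * m) ((k + 1) * m)
  have h2 := card_filter_fin_interval n 0 s
  have h3 := card_filter_fin_interval n (K * m) n
  have e : ((k : ℕ) + 1) * m = k * m + m := by ring
  have hsub : (Finset.univ.filter fun i => blockLabel hK m s σ i = k) ⊆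
      (Finset.univ.filter fun i : Fin n => (k : ℕ) * m ≤ (i : ℕ) ∧ (i : ℕ) < (k + 1) * m) ∪
      (Finset.univ.filter fun i : Fin n => 0 ≤ (i : ℕ) ∧ (i : ℕ) < s) ∪
      (Finset.univ.filter fun i : Fin n => K * m ≤ (i : ℕ) ∧ (i : ℕ) < n) := by
    intro i hi
    simp only [Finset.mem_union, Finset.mem_filter, Finset.mem_univ, true_and] at hi ⊢
    rcases mem_block_of_blockLabel_eq hK hm σ hi with h | h | h
    · exact Or.inl (Or.inl h)
    · exact Or.inl (Or.inr ⟨by omega, h.1⟩)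
    · exact Or.inr ⟨h.1, i.2⟩
  have h4 := Finset.card_le_card hsub
  have h5 := Finset.card_union_le
    ((Finset.univ.filter fun i : Fin n => (k : ℕ) * m ≤ (i : ℕ) ∧ (i : ℕ) < (k + 1) * m) ∪
      (Finset.univ.filter fun i : Fin n => 0 ≤ (i : ℕ) ∧ (i : ℕ) < s))
    (Finset.univ.filter fun i : Fin n => K * m ≤ (i : ℕ) ∧ (i : ℕ) < n)
  have h6 := Finset.card_union_le
    (Finset.univ.filter fun i : Fin n => (k : ℕ) * m ≤ (i : ℕ) ∧ (i : ℕ) < (k + 1) * m)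
      (Finset.univ.filter fun i : Fin n => 0 ≤ (i : ℕ) ∧ (i : ℕ) < s)
  rw [communitySize]
  omega

/-- The overlap of the two models that differ in the label of one uncertain vertex. -/
theorem overlap_blockLabel (hm : 0 < m) (hsm : s ≤ m) (hn : K * m ≤ n) (p q : unitInterval) (k : ℕ)
    {i : Fin n} (hi : (i : ℕ) < s) {σ τ : Fin n → Bool} (hσ : σ i = true) (hτ : τ i = false)
    (hστ : ∀ j, j ≠ i → σ j = τ j) :
    (m.choose k : ℝ) * min ((p : ℝ) ^ k * (1 - p) ^ (m - k)) ((q : ℝ) ^ k * (1 - q) ^ (m - k)) ≤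
      ∑ x : LowerPairs n → Bool,
        min (∏ e : LowerPairs n, bernoulliMass (halfGraphMatrix K p q
            (blockLabel hK m s σ e.1.1) (blockLabel hK m s σ e.1.2)) (x e))
          (∏ e : LowerPairs n, bernoulliMass (halfGraphMatrix K p q
            (blockLabel hK m s τ e.1.1) (blockLabel hK m s τ e.1.2)) (x e)) := by
  have hKm : K * m = (K - 1) * m + m := by
    rw [← Nat.succ_mul]; congr 1; omega
  have hK2 : 2 * m ≤ (K - 1) * m := Nat.mul_le_mul_right m (by omega)
  set B := Finset.univ.filter fun j : Fin n => (K - 1) * m ≤ (j : ℕ) ∧ (j : ℕ) < K * m with hB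
  -- The edges from i to the last block. K ≥ 3 keeps B clear of the uncertain vertices and makes its
  -- label differ from 0 and 1; i precedes B, so i is the second entry of these pairs.
  set E : Finset (LowerPairs n) := Finset.univ.filter fun e => e.1.2 = i ∧ e.1.1 ∈ B with hE
  have hBcard : B.card = m := by
    rw [hB, card_filter_fin_interval]; omega
  have hBi : ∀ j ∈ B, i < j := by
    intro j hj
    simp only [hB, Finset.mem_filter, Finset.mem_univ, true_and] at hj
    exact Fin.lt_def.2 (by omega)
  have hEcard : E.card = m := by
    rw [← hBcard]
    refine Finset.card_bij (fun e _ => e.1.1) (fun e he => (Finset.mem_filter.1 he).2.2) ?_ ?_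
    · intro e he e' he' hee
      exact Subtype.ext (Prod.ext hee
        ((Finset.mem_filter.1 he).2.1.trans (Finset.mem_filter.1 he').2.1.symm))
    · intro j hj
      exact ⟨⟨(j, i), hBi j hj⟩, Finset.mem_filter.2 ⟨Finset.mem_univ _, rfl, hj⟩, rfl⟩
  have hlast : ∀ (ρ : Fin n → Bool) (j : Fin n),
      ((blockLabel hK m s ρ j : Fin K) : ℕ) = K - 1 ↔ j ∈ B := by
    intro ρ j
    simp only [hB, Finset.mem_filter, Finset.mem_univ, true_and]
    constructor
    · intro h
      have := mem_block_of_blockLabel_eq hK hm ρ (i := j) (k := ⟨K - 1, by omega⟩) (Fin.ext h)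
      simp only [Nat.sub_add_cancel (by omega : 1 ≤ K)] at this
      omega
    · intro h
      rw [blockLabel_eq_of_mem_block hK ρ (i := j) (k := ⟨K - 1, by omega⟩) (by omega) h.1
        (by simp only [Nat.sub_add_cancel (by omega : 1 ≤ K)]; exact h.2)]
  have hσi : ((blockLabel hK m s σ i : Fin K) : ℕ) = 1 := by
    rw [blockLabel_of_lt hK hsm σ hi, if_pos hσ]
  have hτi : ((blockLabel hK m s τ i : Fin K) : ℕ) = 0 := by
    rw [blockLabel_of_lt hK hsm τ hi, if_neg (by simp [hτ])]
  have hoff : ∀ j, j ≠ i → (blockLabel hK m s σ j : Fin K) = blockLabel hK m s τ j :=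
    fun j hj => blockLabel_congr hK (Or.inl (hστ j hj))
  have key := overlap_prod_bernoulliMass E
    (fun e => halfGraphMatrix K p q (blockLabel hK m s σ e.1.1) (blockLabel hK m s σ e.1.2))
    (fun e => halfGraphMatrix K p q (blockLabel hK m s τ e.1.1) (blockLabel hK m s τ e.1.2))
    p q ?_ ?_ ?_ k
  · rwa [hEcard] at key
  · intro e he
    obtain ⟨-, h1, h2⟩ := Finset.mem_filter.1 he
    have := (hlast σ e.1.1).2 h2
    simp only [halfGraphMatrix, h1]
    exact if_pos (by omega)
  · intro e he
    obtain ⟨-, h1, h2⟩ := Finset.mem_filter.1 he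
    have := (hlast τ e.1.1).2 h2
    simp only [halfGraphMatrix, h1]
    exact if_neg (by omega)
  · intro e he
    by_cases h2 : e.1.2 = i
    · have h1 : e.1.1 ∉ B := fun h => he (Finset.mem_filter.2 ⟨Finset.mem_univ _, h2, h⟩)
      have h3 : e.1.1 ≠ i := fun h => absurd e.2 (by rw [h, h2]; exact lt_irrefl i)
      have h4 : ((blockLabel hK m s τ e.1.1 : Fin K) : ℕ) ≠ K - 1 := fun h => h1 ((hlast τ _).1 h)
      have h5 := (blockLabel hK m s τ e.1.1).2
      simp only [halfGraphMatrix, h2, hoff _ h3]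
      rw [if_neg (by omega), if_neg (by omega)]
    · by_cases h1 : e.1.1 = i
      · have h3 : (e.1.2 : ℕ) < i := by rw [← h1]; exact e.2
        have h4 := blockLabel_of_lt hK hsm τ (i := e.1.2) (by omega)
        have h5 : ((blockLabel hK m s τ e.1.2 : Fin K) : ℕ) ≤ 1 := by
          rw [h4]; split_ifs <;> omega
        simp only [halfGraphMatrix, h1, hoff _ h2]
        rw [if_neg (by omega), if_neg (by omega)]
      · simp only [hoff _ h1, hoff _ h2]

theorem admissible_blockLabel {β ε ω ω' : ℝ} (hm : 0 < m) (hsm : s ≤ m) (hn : K * m ≤ n)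
    {p q : unitInterval} (hq0 : 0 < (q : ℝ)) (hqp : (q : ℝ) < p) (hp1 : (p : ℝ) < 1)
    (hpε : (p : ℝ) ≤ 1 - ε) (hpω' : ω' ≤ (p : ℝ) / q) (hpω : (p : ℝ) / q ≤ ω)
    (hlow : (n : ℝ) / (β * K) ≤ ((m - s : ℕ) : ℝ))
    (hup : ((m + s + (n - K * m) : ℕ) : ℝ) ≤ β * n / K) (σ : Fin n → Bool) :
    Admissible β ε ω ω' p (chernoffInfo (binomial m p) (binomial m q)) (blockLabel hK m s σ)
      (halfGraphMatrix K p q) := by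
  have hp0 : (0 : ℝ) < p := hq0.trans hqp
  have hor : ∀ k l, halfGraphMatrix K p q k l = p ∨ halfGraphMatrix K p q k l = q := by
    intro k l
    simp only [halfGraphMatrix]
    split_ifs <;> simp
  have hpos : ∀ k l, 0 < (halfGraphMatrix K p q k l : ℝ) := fun k l => by
    rcases hor k l with h | h <;> rw [h] <;> assumption
  have hlt : ∀ k l, (halfGraphMatrix K p q k l : ℝ) < 1 := fun k l => by
    rcases hor k l with h | h <;> rw [h] <;> linarith
  have h1ω : 1 ≤ (p : ℝ) / q := by rw [one_le_div hq0]; exact hqp.le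
  have hqp' : (q : ℝ) / p ≤ 1 := by rw [div_le_one hp0]; exact hqp.le
  have hrow : ∀ k l : Fin K, k < l → ∃ r : Fin K, 1 ≤ (r : ℕ) ∧
      halfGraphMatrix K p q k r = q ∧ halfGraphMatrix K p q l r = p := by
    intro k l hkl
    have hkl' : (k : ℕ) < l := hkl
    have hl := l.2
    -- Column K - l is where row l first takes the value p, while the earlier row k is still at q.
    refine ⟨⟨K - l, by omega⟩, ?_, if_neg ?_, if_pos ?_⟩ <;> simp only <;> omega
  have hchern : ∀ k l : Fin K, k < l → chernoffInfo (binomial m p) (binomial m q) ≤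
      chernoffInfo (bernoulliVector fun j => halfGraphMatrix K p q l (blockLabel hK m s σ j))
        (bernoulliVector fun j => halfGraphMatrix K p q k (blockLabel hK m s σ j)) := by
    intro k l hkl
    obtain ⟨r, hr, hkr, hlr⟩ := hrow k l hkl
    refine chernoffInfo_binomial_le_bernoulliVector (fun j => ⟨hpos _ _, hlt _ _⟩)
      (fun j => ⟨hpos _ _, hlt _ _⟩) ⟨hp0, hp1⟩ ⟨hq0, hqp.trans hp1⟩
      (T := Finset.univ.filter fun j => blockLabel hK m s σ j = r)
      (le_communitySize_blockLabel_of_pos hK hsm hn σ r hr) ?_ ?_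
    · intro j hj
      rw [(Finset.mem_filter.1 hj).2, hlr]
    · intro j hj
      rw [(Finset.mem_filter.1 hj).2, hkr]
  refine ⟨hpos, hlt, ?_, fun k => ⟨?_, ?_⟩, ⟨?_, ?_⟩, hpε, ?_, ?_, ?_⟩
  · ext k l
    simp only [Matrix.transpose_apply, halfGraphMatrix, add_comm]
  · exact hlow.trans (by exact_mod_cast le_communitySize_blockLabel hK hn σ k)
  · exact le_trans (by exact_mod_cast communitySize_blockLabel_le hK hm hn σ k) hup
  · intro k l
    rcases hor k l with h | h <;> rw [h]
    exact hqp.le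
  · refine ⟨⟨K - 1, by omega⟩, ⟨K - 1, by omega⟩, if_pos ?_⟩
    simp only; omega
  · intro k l k' l'
    rcases hor k l with h | h <;> rcases hor k' l' with h' | h' <;> rw [h, h']
    · rw [div_self hp0.ne']; linarith
    · exact hpω
    · linarith
    · rw [div_self hq0.ne']; linarith
  · intro k l hkl
    rcases lt_or_gt_of_ne hkl with h | h
    · obtain ⟨r, -, hkr, hlr⟩ := hrow k l h
      exact ⟨r, by rw [hkr, hlr]; exact hpω'.trans (le_max_right _ _)⟩
    · obtain ⟨r, -, hkr, hlr⟩ := hrow l k h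
      exact ⟨r, by rw [hkr, hlr]; exact hpω'.trans (le_max_left _ _)⟩
  · intro k l hkl
    rcases lt_or_gt_of_ne hkl with h | h
    · rw [chernoffInfo_comm (bernoulliVector _)]
      exact hchern k l h
    · exact hchern l k h

end blockLabel

/-! ### Assembling the bound and choosing the constants -/

theorem minimaxRisk_ge_of_blockLabel {n K m s : ℕ} (hK : 3 ≤ K) {β ε ω ω' : ℝ} (hm : 0 < m) (hsm : 5 * s ≤ m)
    (hn : K * m ≤ n) {p q : unitInterval} (hq0 : 0 < (q : ℝ)) (hqp : (q : ℝ) < p)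
    (hp1 : (p : ℝ) < 1) (hpε : (p : ℝ) ≤ 1 - ε) (hpω' : ω' ≤ (p : ℝ) / q) (hpω : (p : ℝ) / q ≤ ω)
    (hlow : (n : ℝ) / (β * K) ≤ ((m - s : ℕ) : ℝ))
    (hup : ((m + s + (n - K * m) : ℕ) : ℝ) ≤ β * n / K) (k : ℕ) :
    (1 / (n : ℝ)) * (s * (((m.choose k : ℝ) *
      min ((p : ℝ) ^ k * (1 - p) ^ (m - k)) ((q : ℝ) ^ k * (1 - q) ^ (m - k))) / 2)) ≤
      minimaxRisk (paramSpace β ε ω ω' n p K (chernoffInfo (binomial m p) (binomial m q))) := by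
  have : Nonempty (Estimator n K) := ⟨fun _ => PMF.pure fun _ => ⟨0, by omega⟩⟩
  refine le_ciInf fun zhat => ?_
  have hsm' : s ≤ m := by omega
  set S := Finset.univ.filter fun i : Fin n => 0 ≤ (i : ℕ) ∧ (i : ℕ) < s with hS
  have hmn : 1 * m ≤ K * m := Nat.mul_le_mul_right m (by omega)
  have hScard : S.card = s := by
    rw [hS, card_filter_fin_interval]; omega
  have hSlt : ∀ i, i ∈ S ↔ (i : ℕ) < s := fun i => by simp [hS]
  obtain ⟨σ, hσ⟩ := exists_risk_ge (blockLabel hK m s) (halfGraphMatrix K p q) S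
    ((m.choose k : ℝ) * min ((p : ℝ) ^ k * (1 - p) ^ (m - k)) ((q : ℝ) ^ k * (1 - q) ^ (m - k)))
    (exists_perm_sum_le_mis _ (fun _ => false) S
      (fun σ i hi => blockLabel_congr hK (Or.inr (not_lt.1 fun h => hi ((hSlt i).2 h))))
      -- 5s ≤ m is what gives communities of size at least m - s ≥ 4s.
      fun k => le_trans (by omega) (le_communitySize_blockLabel hK hn _ k))
    (by
      intro i hi σ h
      have h' := congrArg Fin.val h
      rw [blockLabel_of_lt hK hsm' _ ((hSlt i).1 hi), blockLabel_of_lt hK hsm' _ ((hSlt i).1 hi)]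
        at h'
      cases hb : σ i <;> simp [flipAt, hb] at h')
    (by
      intro i hi σ
      have hflip : ∀ j, j ≠ i → σ j = flipAt i σ j := fun j hj => by simp [flipAt, hj]
      rcases hb : σ i with _ | _
      · simp only [min_comm (∏ e : LowerPairs n, bernoulliMass (halfGraphMatrix K p q
            (blockLabel hK m s σ e.1.1) (blockLabel hK m s σ e.1.2)) _)]
        exact overlap_blockLabel hK hm hsm' hn p q k ((hSlt i).1 hi) (by simp [flipAt, hb]) hb
          fun j hj => (hflip j hj).symm
      · exact overlap_blockLabel hK hm hsm' hn p q k ((hSlt i).1 hi) hb (by simp [flipAt, hb])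
          hflip)
    zhat
  rw [hScard] at hσ
  refine hσ.trans (le_ciSup (f := fun θ : paramSpace β ε ω ω' n p K
    (chernoffInfo (binomial m p) (binomial m q)) => risk zhat θ) ⟨1, ?_⟩
    ⟨(blockLabel hK m s σ, halfGraphMatrix K p q),
      admissible_blockLabel hK hm hsm' hn hq0 hqp hp1 hpε hpω' hpω hlow hup σ⟩)
  rintro _ ⟨θ, rfl⟩
  exact risk_le_one _ _

end SBM

theorem mainTheorem5 (β ε ω ω' : ℝ) (Kstar : ℕ)
    (hβ : 1 < β) (hε : ε ∈ Set.Ioo (0 : ℝ) 1) (hω : 1 < ω) (hω' : 1 < ω') :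
    ∃ C : ℝ, 0 < C ∧ ∃ c : ℝ, 0 < c ∧
      ∀ (n K : ℕ) (pstar : unitInterval) (Dstar : ℝ),
        3 ≤ K → K ≤ Kstar → C ≤ (n : ℝ) * pstar →
        (∃ q : unitInterval, 0 < (q : ℝ) ∧ (q : ℝ) < pstar ∧ (pstar : ℝ) ≤ 1 - ε ∧
          ω' ≤ (pstar : ℝ) / q ∧ (pstar : ℝ) / q ≤ ω ∧
          Dstar = chernoffInfo (binomial (n / K) pstar) (binomial (n / K) q)) →
        c * (1 / Real.sqrt ((n : ℝ) * pstar) * Real.exp (-Dstar)) ≤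
          SBM.minimaxRisk (SBM.paramSpace β ε ω ω' n pstar K Dstar) := by
  obtain ⟨hε0, hε1⟩ := hε
  have hβ1 : 0 < β - 1 := by linarith
  have hβ0 : 0 < β := by linarith
  have hω0 : 0 < ω := by linarith
  -- The uncertain share of a block: 1/16 ensures 5s ≤ m, the other term keeps communities balanced.
  set γ : ℝ := min (1 / 16) ((β - 1) / (4 * β)) with hγ
  have hγ0 : 0 < γ := lt_min (by norm_num) (by positivity)
  have hγ1 : γ ≤ 1 / 16 := min_le_left _ _
  have hγ2 : γ * (4 * β) ≤ β - 1 := by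
    rw [← le_div_iff₀ (by positivity)]; exact min_le_right _ _
  -- Each summand serves one of `b1` to `b6`, largeness conditions on x = n/K; only the last, for mq
  -- ≥ 1, needs x p* rather than x.
  set X : ℝ := 2 + 2 * β / (β - 1) + 2 * Kstar / (β - 1) + 4 / ε + 2 / γ + 2 * ω with hX
  have hXn1 : 0 < 2 * β / (β - 1) := by positivity
  have hXn2 : 0 ≤ 2 * Kstar / (β - 1) := by positivity
  have hXn3 : 0 < 4 / ε := by positivity
  have hXn4 : 0 < 2 / γ := by positivity
  have hX0 : 0 < X := by linarith
  refine ⟨(Kstar + 1) * X, by positivity, γ / (4 * (Kstar + 1)) * (Real.exp (-4) * (ε / ω)),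
    by positivity, ?_⟩
  rintro n K pstar _ hK hKK hC ⟨q, hq0, hqp, hpε, hpω', hpω, rfl⟩
  have hp0 : (0 : ℝ) < pstar := hq0.trans hqp
  have hp1 : (pstar : ℝ) < 1 := by linarith
  have hK0 : (0 : ℝ) < K := by exact_mod_cast (by omega : 0 < K)
  have hKK' : (K : ℝ) ≤ Kstar := by exact_mod_cast hKK
  have hnp : (K : ℝ) * X ≤ n * pstar :=
    (mul_le_mul_of_nonneg_right (by linarith) hX0.le).trans hC
  have hn0 : (0 : ℝ) < n := by
    rcases Nat.eq_zero_or_pos n with h | h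
    · subst h
      have : 0 < (K : ℝ) * X := by positivity
      norm_num at hnp
      linarith
    · exact_mod_cast h
  set x : ℝ := n / K with hx
  have hxK : x * K = n := by rw [hx]; field_simp
  have hxp : X ≤ x * pstar := by
    have : (K : ℝ) * X ≤ K * (x * pstar) := by rw [← mul_assoc, mul_comm (K : ℝ) x, hxK]; exact hnp
    exact le_of_mul_le_mul_left this hK0
  have hx0 : 0 < x := by positivity
  have hxX : X ≤ x := hxp.trans (mul_le_of_le_one_right hx0.le hp1.le)
  set m := n / K with hm
  have hmx : (m : ℝ) ≤ x := Nat.cast_div_le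
  have hxm : x < m + 1 := by
    rw [hx, div_lt_iff₀ hK0]
    have := Nat.lt_mul_div_succ n (by omega : 0 < K)
    have h2 : (n : ℝ) < (K : ℝ) * ((n / K : ℕ) + 1) := by exact_mod_cast this
    linarith
  set s := ⌊γ * x⌋₊ with hs
  have hsx : (s : ℝ) ≤ γ * x := Nat.floor_le (by positivity)
  have hxs : γ * x < s + 1 := Nat.lt_floor_add_one _
  have b1 : 2 ≤ x := by linarith
  have b2 : 2 * β ≤ x * (β - 1) := by rw [← div_le_iff₀ hβ1]; linarith
  have b3 : 2 * Kstar ≤ x * (β - 1) := by rw [← div_le_iff₀ hβ1]; linarith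
  have b4 : 4 ≤ x * ε := by rw [← div_le_iff₀ hε0]; linarith
  have b5 : 2 ≤ x * γ := by rw [← div_le_iff₀ hγ0]; linarith
  have b6 : 2 * ω ≤ x * pstar := by linarith
  have hn : K * m ≤ n := Nat.mul_div_le n K
  have hm0 : 0 < m := by
    have : (0 : ℝ) < m := by linarith
    exact_mod_cast this
  have hsm : 5 * s ≤ m := by
    have : 5 * (s : ℝ) ≤ m := by linarith [mul_le_mul_of_nonneg_right hγ1 hx0.le]
    exact_mod_cast this
  have hlow : (n : ℝ) / (β * K) ≤ ((m - s : ℕ) : ℝ) := by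
    rw [Nat.cast_sub (by omega), mul_comm, ← div_div, ← hx, div_le_iff₀ hβ0]
    have h1 : (x - 1 - γ * x) * β ≤ ((m : ℝ) - s) * β :=
      mul_le_mul_of_nonneg_right (by linarith) hβ0.le
    have h2 : γ * (4 * β) * x ≤ (β - 1) * x := mul_le_mul_of_nonneg_right hγ2 hx0.le
    linarith
  have hup : ((m + s + (n - K * m) : ℕ) : ℝ) ≤ β * n / K := by
    have h1 : n - K * m < K := by
      have : n - K * m = n % K := by
        have := Nat.div_add_mod n K
        rw [← hm] at this
        omega
      rw [this]; exact Nat.mod_lt _ (by omega)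
    have h2 : ((n - K * m : ℕ) : ℝ) ≤ K := by exact_mod_cast h1.le
    have h3 : β * n / K = β * x := by rw [hx]; ring
    have h4 : γ * (4 * β) * x ≤ (β - 1) * x := mul_le_mul_of_nonneg_right hγ2 hx0.le
    have h5 : γ * 1 * x ≤ γ * β * x := by gcongr
    rw [h3, Nat.cast_add, Nat.cast_add]
    linarith
  have hmq : 1 ≤ m * (q : ℝ) := by
    have h1 : (pstar : ℝ) ≤ ω * q := by rwa [div_le_iff₀ hq0] at hpω
    have h2 : x / 2 ≤ m := by linarith
    have h3 : x * pstar ≤ x * (ω * q) := mul_le_mul_of_nonneg_left h1 hx0.le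
    have h4 : 2 * ω ≤ ω * (x * q) := by linarith
    have h5 : 2 ≤ x * (q : ℝ) := le_of_mul_le_mul_left (by linarith) hω0
    linarith [mul_le_mul_of_nonneg_right h2 hq0.le]
  obtain ⟨k, -, α, hα0, hα1, hV⟩ := exists_common_binomial_point (m := m) hε0 hω0 hq0 hqp hpε hpω
    hmq (by
      linarith [mul_le_mul_of_nonneg_right (show x / 2 ≤ (m : ℝ) by linarith) hε0.le])
  refine le_trans ?_ (SBM.minimaxRisk_ge_of_blockLabel hK hm0 hsm hn hq0 hqp hp1 hpε hpω' hpω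
    hlow hup k)
  have hD := exp_neg_chernoffInfo_binomial_le hp0 hp1 hq0 (hqp.trans hp1) hα0 hα1 m
  set D := chernoffInfo (binomial m pstar) (binomial m q)
  have hmn : (m : ℝ) ≤ n := by exact_mod_cast Nat.div_le_self n K
  have hm0' : (0 : ℝ) < m := by exact_mod_cast hm0
  have hV' : Real.exp (-4) * (ε / ω) * (1 / √(n * pstar) * Real.exp (-D)) ≤
      (m.choose k : ℝ) * min ((pstar : ℝ) ^ k * (1 - pstar) ^ (m - k))
        ((q : ℝ) ^ k * (1 - q) ^ (m - k)) := by
    refine le_trans ?_ hV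
    have h1 : 1 / √((n : ℝ) * pstar) ≤ 1 / √((m : ℝ) * pstar) :=
      one_div_le_one_div_of_le (Real.sqrt_pos.2 (by positivity))
        (Real.sqrt_le_sqrt (by gcongr))
    rw [div_eq_mul_one_div _ (√((m : ℝ) * pstar)), mul_assoc _ (1 / √((m : ℝ) * pstar))]
    gcongr
  -- γx ≥ 2, so the floor s is at least γx/2.
  have hsn : γ / (2 * (Kstar + 1)) ≤ 1 / (n : ℝ) * s := by
    have h1 : γ * x / 2 ≤ s := by linarith
    rw [div_le_iff₀ (by positivity), ← hxK]
    have h2 : 1 / (x * K) * s * (2 * ((Kstar : ℝ) + 1)) = (2 * s / x) * ((Kstar + 1) / K) := by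
      field_simp
    rw [h2]
    have h3 : γ ≤ 2 * s / x := by rw [le_div_iff₀ hx0]; linarith
    have h4 : 1 ≤ ((Kstar : ℝ) + 1) / K := by rw [one_le_div hK0]; linarith
    simpa using mul_le_mul h3 h4 zero_le_one (hγ0.le.trans h3)
  calc _ = γ / (2 * (Kstar + 1)) *
        ((Real.exp (-4) * (ε / ω) * (1 / √(n * pstar) * Real.exp (-D))) / 2) := by
        field_simp; norm_num
    _ ≤ (1 / (n : ℝ) * s) * (((m.choose k : ℝ) * min ((pstar : ℝ) ^ k * (1 - pstar) ^ (m - k))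
        ((q : ℝ) ^ k * (1 - q) ^ (m - k))) / 2) := by gcongr
    _ = _ := by ring
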